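/- Let $N\ge 1$, let $\mathbb T=\{z\in\mathbb C:|z|=1\}$ with normalized Haar measure and $H=L^2(\mathbb T)$. Let $m_0,\dots,m_{N-1}$ and $\tilde m_0,\dots,\tilde m_{N-1}$ be two systems of bounded Borel functions (filters) on $\mathbb T$, let $(S_if)(z)=m_i(z)f(z^N)$ and $(\tilde S_if)(z)=\tilde m_i(z)f(z^N)$ be the corresponding operators on $H$ (the wavelet representations), and let $$A_{k,l}(z)=\frac1N\sum_{w^N=z}w^{-l}m_k(w),\qquad \tilde A_{k,l}(z)=\frac1N\sum_{w^N=z}w^{-l}\tilde m_k(w)\qquad(0\le k,l<N)$$ be their loop matrices. Assume that $A(z)$ and $\tilde A(z)$ are invertible and biorthogonal, $\sum_{k}\overline{A_{k,i}(z)}\,\tilde A_{k,j}(z)=\delta_{i,j}$, for almost every $z$. Let $\mathbf S=(S\ \ \tilde S)$ be the row $(S_0,\dots,S_{N-1},\tilde S_0,\dots,\tilde S_{N-1})\colon H^{2N}\to H$, regarded as an operator on $H^{2N}\oplus H$ that vanishes on the summand $H$, and let $P=\mathbf S^*\mathbf S+\mathbf S\mathbf S^*$. Its block on $H^{2N}$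 is a $2N\times 2N$ matrix $(P_{a,b})$ over $B(H)$, indexed by the letters $1,\dots,N,\tilde 1,\dots,\tilde N$. Let $\mathcal F_{2N}(H,P)$ be the Hilbert space obtained, by dividing out the null vectors and completing, from the finite sums of symbols $w\otimes h$ ($w$ a word in the $2N$ letters, $h\in H$, linear in $h$) with the form, conjugate linear in its first entry, $$\langle a_1\cdots a_k\otimes h,\ b_1\cdots b_n\otimes h'\rangle=\delta_{k,n}\,\langle h, P_{a_1,b_1}\cdots P_{a_k,b_k}h'\rangle ,$$ which is positive semidefinite. Identify $h\in H$ with $e\otimes h$, where $e$ is the empty word. Then: (0) The creation operators $T_a(w\otimes h)=(aw)\otimes h$ are well-defined bounded operators on $\mathcal F_{2N}(H,P)$. Write $T_1,\dots,T_N,\tilde T_1,\dots,\tilde T_N$ for them. (1) For $1\le i,j\le N$, $T_i^*T_j|_H=S_{i-1}^*S_{j-1}$, and this is multiplication by the function $(AA^*)_{j-1,i-1}$. (2) For $1\le i,j\le N$, $\tilde T_i^*\tilde T_j|_H=\tilde S_{i-1}^*\tilde S_{j-1}$, and this is multiplication by the function $(\tilde A\tilde A^*)_{j-1,i-1}$.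 (3) $T_i\tilde T_j^*|_H+\tilde T_j^*T_i|_H=\delta_{i,j}\mathbf 1_H$ for $1\le i,j\le N$. (4) The $*$-algebra $\mathfrak A$ generated by $\tilde T_1,\dots,\tilde T_N$ is an oscillator algebra, in the following sense. Let $\mathcal F^{(n)}$ be the closed span of the vectors $w\otimes h$ with $|w|=n$. The creation operators $\tilde T_j$ lie in $\mathfrak A$ and the $T_i$ in its norm closure; all of them map $\mathcal F^{(n)}$ into $\mathcal F^{(n+1)}$; their adjoints map $\mathcal F^{(n+1)}$ into $\mathcal F^{(n)}$ and vanish on $\mathcal F^{(0)}$; and $T_i\tilde T_j^*+\tilde T_j^*T_i=\delta_{i,j}\mathbf 1$ on $\mathcal F^{(0)}$. (5) This representation contains Cuntz–Toeplitz isometries: the norm closure of $\mathfrak A$ contains operators $W_1,\dots,W_N$ with $W_i^*W_j=\delta_{i,j}\mathbf 1$ and $\sum_iW_iW_i^*\ne\mathbf 1$. If $\tilde A(z)$ is unitary for almost every $z$, then $\tilde T_1,\dots,\tilde T_N$ themselves have these two properties. -/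

import Mathlib

open MeasureTheory Filter
open scoped ENNReal Matrix ComplexConjugate

namespace WaveletFock

noncomputable section

section Fock

variable {ι H : Type*} [NormedAddCommGroup H] [InnerProductSpace ℂ H]

/-- The operators `Φ(e_{i₁ i₁'} ⊗ ⋯ ⊗ e_{i_k i_k'}) = P_{i₁ i₁'} ⋯ P_{i_k i_k'}` attached to two
words of the same length; the value is `0` if the lengths differ, and `1` for two empty words. -/
def wordEntry (P : Matrix ι ι (H →L[ℂ] H)) : List ι → List ι → (H →L[ℂ] H)
  | [], [] => 1
  | i :: w, j :: v => P i j * wordEntry P w v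
  | [], _ :: _ => 0
  | _ :: _, [] => 0

/-- The form `⟨∑ w ⊗ h_w, ∑ v ⊗ k_v⟩ = ∑ ⟨h_w, P_{w,v} k_v⟩` on the finite sums of vectors
`w ⊗ h`, where `w` is a word; `w ⊗ h` is `Finsupp.single w h`. -/
def fockForm (P : Matrix ι ι (H →L[ℂ] H)) (x y : List ι →₀ H) : ℂ :=
  x.sum fun w h => y.sum fun v k => inner ℂ h (wordEntry P w v k)

/-- The form attached to `P` is Hermitian and positive semidefinite. -/
structure IsFockMatrix (P : Matrix ι ι (H →L[ℂ] H)) : Prop where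
  symm : ∀ x y, conj (fockForm P y x) = fockForm P x y
  nonneg : ∀ x, 0 ≤ (fockForm P x x).re

theorem fockForm_add_left (P : Matrix ι ι (H →L[ℂ] H)) (x y z : List ι →₀ H) :
    fockForm P (x + y) z = fockForm P x z + fockForm P y z := by
  unfold fockForm
  rw [Finsupp.sum_add_index']
  · intro w; simp
  · intro w h k
    simp [Finsupp.sum_add]

theorem fockForm_add_right (P : Matrix ι ι (H →L[ℂ] H)) (x y z : List ι →₀ H) :
    fockForm P x (y + z) = fockForm P x y + fockForm P x z := by
  unfold fockForm
  rw [← Finsupp.sum_add]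
  congr 1; ext w h
  rw [Finsupp.sum_add_index']
  · intro w; simp
  · intro w h k
    simp

theorem fockForm_smul_left (P : Matrix ι ι (H →L[ℂ] H)) (x y : List ι →₀ H) (r : ℂ) :
    fockForm P (r • x) y = conj r * fockForm P x y := by
  unfold fockForm
  rw [Finsupp.sum_smul_index' (by simp)]
  simp only [Finsupp.sum, Finset.mul_sum, inner_smul_left]

theorem fockForm_zero_left (P : Matrix ι ι (H →L[ℂ] H)) (y : List ι →₀ H) :
    fockForm P 0 y = 0 := by simp [fockForm]

theorem fockForm_zero_right (P : Matrix ι ι (H →L[ℂ] H)) (y : List ι →₀ H) :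
    fockForm P y 0 = 0 := by simp [fockForm]

theorem fockForm_single (P : Matrix ι ι (H →L[ℂ] H)) (w v : List ι) (h k : H) :
    fockForm P (Finsupp.single w h) (Finsupp.single v k) = inner ℂ h (wordEntry P w v k) := by
  simp [fockForm]

/-- The vector space of finite sums of vectors `w ⊗ h`, with the semi-inner product of `P`. -/
def PreFock (P : Matrix ι ι (H →L[ℂ] H)) (_ : IsFockMatrix P) : Type _ := List ι →₀ H

variable {P : Matrix ι ι (H →L[ℂ] H)} (hP : IsFockMatrix P)

instance : AddCommGroup (PreFock P hP) := inferInstanceAs (AddCommGroup (List ι →₀ H))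
instance : Module ℂ (PreFock P hP) := inferInstanceAs (Module ℂ (List ι →₀ H))

/-- The semi-inner product `fockForm P`. -/
@[reducible]
def PreFock.core : PreInnerProductSpace.Core ℂ (PreFock P hP) where
  inner x y := fockForm P x y
  conj_inner_symm x y := hP.symm x y
  re_inner_nonneg x := hP.nonneg x
  add_left x y z := fockForm_add_left P x y z
  smul_left x y r := fockForm_smul_left P x y r

instance : SeminormedAddCommGroup (PreFock P hP) :=
  @InnerProductSpace.Core.toSeminormedAddCommGroup ℂ _ _ _ _ (PreFock.core hP)

instance : InnerProductSpace ℂ (PreFock P hP) := InnerProductSpace.ofCore (PreFock.core hP)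

/-- The Fock space `F(H, P)`: the Hilbert space completion of the quotient of the finite sums of
vectors `w ⊗ h` by the kernel of the form (the completion of a seminormed space is Hausdorff, so it
factors through that quotient). -/
abbrev FockSpace (P : Matrix ι ι (H →L[ℂ] H)) (hP : IsFockMatrix P) : Type _ :=
  UniformSpace.Completion (PreFock P hP)

/-- The vector `w ⊗ h` of the Fock space. -/
def fockVec (w : List ι) (h : H) : FockSpace P hP :=
  UniformSpace.Completion.coe' (α := PreFock P hP) (Finsupp.single w h : List ι →₀ H)

/-- The canonical map of the finite sums of vectors `w ⊗ h` to the Fock space. -/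
def toFock : PreFock P hP →ₗ[ℂ] FockSpace P hP :=
  (UniformSpace.Completion.toComplL (𝕜 := ℂ) (E := PreFock P hP)).toLinearMap

/-- The linear map `w ⊗ h ↦ (iw) ⊗ h` on finite sums. -/
def prependLetter (i : ι) : PreFock P hP →ₗ[ℂ] PreFock P hP :=
  (Finsupp.lmapDomain H ℂ (List.cons i) : (List ι →₀ H) →ₗ[ℂ] (List ι →₀ H))

/-- The left creation operator `T_i (w ⊗ h) = (iw) ⊗ h`, extended by continuity. -/
def creation (i : ι) : FockSpace P hP →L[ℂ] FockSpace P hP :=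
  ((toFock hP).comp (prependLetter hP i)).extendOfNorm (toFock hP)

end Fock
section Grading

variable {ι H : Type*} [NormedAddCommGroup H] [InnerProductSpace ℂ H]
  {P : Matrix ι ι (H →L[ℂ] H)}

/-- The `n`-particle space: the closed linear span of the vectors `w ⊗ h` with `|w| = n`. -/
def particleSpace (hP : IsFockMatrix P) (n : ℕ) : Submodule ℂ (FockSpace P hP) :=
  (Submodule.span ℂ {ψ | ∃ (w : List ι) (h : H), w.length = n ∧ ψ = fockVec hP w h}).topologicalClosure

end Grading

section Oscillator

variable {κ F : Type*} [DecidableEq κ] [NormedAddCommGroup F] [InnerProductSpace ℂ F]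
  [CompleteSpace F]

/-- `𝔄` is a (Fermi) oscillator algebra on a graded Hilbert space, with creation operators `a i`,
`b i` (`b i` in `𝔄`, `a i` in its norm closure) and annihilation operators their adjoints:
creation operators raise the particle number by one, annihilation operators lower it by one and
annihilate the vacuum sector `V 0`, and `a_i b_j* + b_j* a_i = δ_{ij} 1` holds on `V 0`. -/
structure IsOscillatorAlgebra (V : ℕ → Submodule ℂ F) (𝔄 : StarSubalgebra ℂ (F →L[ℂ] F))
    (a b : κ → (F →L[ℂ] F)) : Prop where
  b_mem : ∀ i, b i ∈ 𝔄
  a_mem : ∀ i, a i ∈ 𝔄.topologicalClosure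
  a_raise : ∀ i n, ∀ ψ ∈ V n, a i ψ ∈ V (n + 1)
  b_raise : ∀ i n, ∀ ψ ∈ V n, b i ψ ∈ V (n + 1)
  a_lower : ∀ i n, ∀ ψ ∈ V (n + 1), star (a i) ψ ∈ V n
  b_lower : ∀ i n, ∀ ψ ∈ V (n + 1), star (b i) ψ ∈ V n
  a_vacuum : ∀ i, ∀ ψ ∈ V 0, star (a i) ψ = 0
  b_vacuum : ∀ i, ∀ ψ ∈ V 0, star (b i) ψ = 0
  anticomm : ∀ i j, ∀ ψ ∈ V 0,
    a i (star (b j) ψ) + star (b j) (a i ψ) = (if i = j then (1 : ℂ) else 0) • ψ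

/-- Cuntz–Toeplitz isometries: isometries with mutually orthogonal ranges that do not
span the whole space. -/
structure IsCuntzToeplitz [Fintype κ] (W : κ → (F →L[ℂ] F)) : Prop where
  star_mul : ∀ i j, star (W i) * W j = if i = j then 1 else 0
  sum_ne : ∑ i, W i * star (W i) ≠ 1

end Oscillator

section Factor

variable {ι κ H : Type*} [NormedAddCommGroup H] [InnerProductSpace ℂ H]

/-- Removal of the first letter, weighted by the operators `C i l`. -/
def peel (C : ι → κ → (H →L[ℂ] H)) (l : κ) (x : List ι →₀ H) : List ι →₀ H :=
  x.sum fun w h => match w with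
    | [] => 0
    | i :: w => Finsupp.single w (C i l h)

theorem peel_add (C : ι → κ → (H →L[ℂ] H)) (l : κ) (x y : List ι →₀ H) :
    peel C l (x + y) = peel C l x + peel C l y := by
  unfold peel
  rw [Finsupp.sum_add_index']
  · rintro (_ | ⟨i, w⟩) <;> simp
  · rintro (_ | ⟨i, w⟩) <;> simp

theorem peel_zero (C : ι → κ → (H →L[ℂ] H)) (l : κ) : peel C l 0 = 0 := by simp [peel]

theorem peel_nil (C : ι → κ → (H →L[ℂ] H)) (l : κ) (h : H) :
    peel C l (Finsupp.single [] h) = 0 := by simp [peel]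

theorem peel_cons (C : ι → κ → (H →L[ℂ] H)) (l : κ) (i : ι) (w : List ι) (h : H) :
    peel C l (Finsupp.single (i :: w) h) = Finsupp.single w (C i l h) := by simp [peel]

theorem peel_ne_zero (C : ι → κ → (H →L[ℂ] H)) (l : κ) (x : List ι →₀ H) (v : List ι)
    (hv : peel C l x v ≠ 0) : ∃ i, x (i :: v) ≠ 0 := by
  classical
  unfold peel at hv
  rw [Finsupp.sum_apply] at hv
  obtain ⟨w, hw, hne⟩ := Finset.exists_ne_zero_of_sum_ne_zero hv
  rcases w with _ | ⟨i, w⟩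
  · simp at hne
  · by_cases hwv : w = v
    · subst hwv
      exact ⟨i, by simpa using hw⟩
    · simp [hwv] at hne

variable {C : ι → κ → (H →L[ℂ] H)} {P : Matrix ι ι (H →L[ℂ] H)}

theorem wordEntry_commute {B : H →L[ℂ] H} (hB : ∀ i j, Commute (P i j) B) (w v : List ι) :
    Commute (wordEntry P w v) B := by
  induction w generalizing v with
  | nil => cases v <;> simp [wordEntry]
  | cons i w ih =>
    cases v with
    | nil => simp [wordEntry]
    | cons j v => exact (hB i j).mul_left (ih v)

variable [CompleteSpace H]

theorem star_wordEntry (hP : ∀ i j i' j', Commute (P i j) (P i' j'))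
    (hs : ∀ i j, star (P i j) = P j i) (w v : List ι) :
    star (wordEntry P w v) = wordEntry P v w := by
  induction w generalizing v with
  | nil => cases v <;> simp [wordEntry]
  | cons i w ih =>
    cases v with
    | nil => simp [wordEntry]
    | cons j v =>
      simp only [wordEntry, star_mul, ih, hs]
      exact wordEntry_commute (fun _ _ => hP _ _ _ _) v w

variable [Fintype κ]

theorem fockForm_peel (hPC : ∀ i j i' l, Commute (P i j) (C i' l))
    (h : ∀ i j, P i j = ∑ l, star (C i l) * C j l) (x y : List ι →₀ H) :
    fockForm P x y = inner ℂ (x []) (y []) + ∑ l, fockForm P (peel C l x) (peel C l y) := by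
  classical
  induction x using Finsupp.induction_linear with
  | zero => simp [fockForm_zero_left, peel_zero]
  | add x x' hx hx' =>
    simp only [fockForm_add_left, peel_add, hx, hx', Finsupp.add_apply, inner_add_left,
      Finset.sum_add_distrib]
    ring
  | single w a =>
    induction y using Finsupp.induction_linear with
    | zero => simp [fockForm_zero_right, peel_zero]
    | add x x' hx hx' =>
      simp only [fockForm_add_right, peel_add, hx, hx', Finsupp.add_apply, inner_add_right,
        Finset.sum_add_distrib]
      ring
    | single v b =>
      rcases w with _ | ⟨i, w⟩ <;> rcases v with _ | ⟨j, v⟩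
      · simp [fockForm_single, peel_nil, fockForm_zero_left, wordEntry]
      · simp [fockForm_single, peel_nil, fockForm_zero_left, wordEntry]
      · simp [fockForm_single, peel_nil, fockForm_zero_right, wordEntry]
      · simp only [fockForm_single, peel_cons, wordEntry]
        have : ∀ l, inner ℂ (C i l a) (wordEntry P w v (C j l b))
            = inner ℂ a ((star (C i l) * C j l) (wordEntry P w v b)) := by
          intro l
          have hc := wordEntry_commute (fun i' j' => hPC i' j' j l) w v
          have h2 : wordEntry P w v (C j l b) = C j l (wordEntry P w v b) :=
            congrArg (fun T : H →L[ℂ] H => T b) hc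
          rw [h2, ContinuousLinearMap.star_eq_adjoint, mul_apply_eq_comp,
            ContinuousLinearMap.adjoint_inner_right]
        simp only [this, ← inner_sum]
        rw [h i j]
        simp [inner_sum]

theorem isFockMatrix_of_factor
    (hCC : ∀ i l j m, Commute (C i l) (C j m))
    (hCS : ∀ i l j m, Commute (star (C i l)) (C j m))
    (h : ∀ i j, P i j = ∑ l, star (C i l) * C j l) : IsFockMatrix P := by
  have hSS : ∀ i l j m, Commute (star (C i l)) (star (C j m)) := fun i l j m =>
    (hCC i l j m).star_star
  have hPC : ∀ i j i' l, Commute (P i j) (C i' l) := by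
    intro i j i' l
    rw [h]
    exact Commute.sum_left _ _ _ fun k _ => (hCS _ _ _ _).mul_left (hCC _ _ _ _)
  have hPS : ∀ i j i' l, Commute (P i j) (star (C i' l)) := by
    intro i j i' l
    rw [h]
    exact Commute.sum_left _ _ _ fun k _ => (hSS _ _ _ _).mul_left (hCS _ _ _ _).symm
  have hP : ∀ i j i' j', Commute (P i j) (P i' j') := by
    intro i j i' j'
    rw [h i' j']
    exact Commute.sum_right _ _ _ fun k _ => (hPS _ _ _ _).mul_right (hPC _ _ _ _)
  have hs : ∀ i j, star (P i j) = P j i := by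
    intro i j
    simp [h, star_sum]
  constructor
  · intro x y
    induction x using Finsupp.induction_linear with
    | zero => simp [fockForm_zero_left, fockForm_zero_right]
    | add x x' hx hx' => simp [fockForm_add_left, fockForm_add_right, hx, hx']
    | single w a =>
      induction y using Finsupp.induction_linear with
      | zero => simp [fockForm_zero_left, fockForm_zero_right]
      | add x x' hx hx' => simp only [fockForm_add_left, fockForm_add_right, map_add, hx, hx']
      | single v b =>
        rw [fockForm_single, fockForm_single, inner_conj_symm, ← star_wordEntry hP hs w v,
          ContinuousLinearMap.star_eq_adjoint, ContinuousLinearMap.adjoint_inner_left]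
  · suffices H : ∀ (n : ℕ) (x : List ι →₀ H), (∀ w, x w ≠ 0 → w.length < n) →
        0 ≤ (fockForm P x x).re by
      intro x
      refine H (x.support.sup List.length + 1) x fun w hw => Nat.lt_succ_of_le ?_
      exact Finset.le_sup (f := List.length) (by simpa using hw)
    intro n
    induction n with
    | zero =>
      intro x hx
      have : x = 0 := by
        ext w
        by_contra hw
        exact absurd (hx w hw) (by simp)
      simp [this, fockForm_zero_left]
    | succ n ih =>
      intro x hx
      rw [fockForm_peel hPC h, Complex.add_re, Complex.re_sum]
      refine add_nonneg (inner_self_nonneg (𝕜 := ℂ)) (Finset.sum_nonneg fun l _ => ih _ ?_)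
      intro v hv
      obtain ⟨i, hi⟩ := peel_ne_zero C l x v hv
      simpa using hx _ hi

end Factor

section Wavelet

instance : MeasurableSpace Circle := borel Circle
instance : BorelSpace Circle := ⟨rfl⟩

/-- Normalized Haar (arc length) measure on the circle `𝕋 = {z : |z| = 1}`. -/
def haarCircle : Measure Circle := Measure.haarMeasure ⊤

instance : haarCircle.IsHaarMeasure := by unfold haarCircle; infer_instance

instance : IsProbabilityMeasure haarCircle :=
  ⟨by simpa [haarCircle] using Measure.haarMeasure_self (K₀ := (⊤ : TopologicalSpace.PositiveCompacts Circle))⟩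

/-- The Hilbert space `L²(𝕋)`. -/
abbrev L2Circle : Type := Lp ℂ 2 haarCircle

/-- Bounded Borel functions on the circle. -/
structure IsBddBorel (g : Circle → ℂ) : Prop where
  measurable : Measurable g
  bounded : ∃ C : ℝ, ∀ z, ‖g z‖ ≤ C

theorem IsBddBorel.memLp {g : Circle → ℂ} (hg : IsBddBorel g) : MemLp g ∞ haarCircle := by
  obtain ⟨C, hC⟩ := hg.bounded
  exact memLp_top_of_bound hg.measurable.aestronglyMeasurable C (ae_of_all _ hC)

/-- Multiplication by a bounded Borel function, on `L²(𝕋)`. -/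
def mulOp (g : Circle → ℂ) (hg : IsBddBorel g) : L2Circle →L[ℂ] L2Circle :=
  (ContinuousLinearMap.mul ℂ ℂ).holderL haarCircle ∞ 2 2 (hg.memLp.toLp g)

theorem mulOp_ae (g : Circle → ℂ) (hg : IsBddBorel g) (f : L2Circle) :
    mulOp g hg f =ᵐ[haarCircle] fun z => g z * f z := by
  have h1 := (ContinuousLinearMap.mul ℂ ℂ).coeFn_holder (r := 2) (hg.memLp.toLp g) f
  have h2 := hg.memLp.coeFn_toLp
  filter_upwards [h1, h2] with z h1 h2
  rw [← h2]
  exact h1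

/-- An `N`-th root. -/
def rootBranch (N : ℕ) (z : Circle) : Circle := Circle.exp (Complex.arg z / N)

theorem measurable_rootBranch (N : ℕ) : Measurable (rootBranch N) := by
  unfold rootBranch
  have : Measurable fun z : Circle => Complex.arg (z : ℂ) :=
    Complex.measurable_arg.comp (by fun_prop : Continuous fun z : Circle => (z : ℂ)).measurable
  exact Circle.exp.continuous.measurable.comp (this.div_const _)

/-- A primitive `N`-th root of unity. -/
def rootUnity (N : ℕ) : Circle := Circle.exp (2 * Real.pi / N)

variable {N : ℕ}

/-- `m_i` on the `k`-th branch of the `N`-th root. -/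
def branchFun (N : ℕ) (g : Circle → ℂ) (k : Fin N) (z : Circle) : ℂ :=
  ((Real.sqrt N)⁻¹ : ℂ) * g (rootUnity N ^ (k : ℕ) * rootBranch N z)

theorem isBddBorel_branchFun {g : Circle → ℂ} (hg : IsBddBorel g) (k : Fin N) :
    IsBddBorel (branchFun N g k) := by
  refine ⟨(hg.measurable.comp ((measurable_rootBranch N).const_mul _)).const_mul _, ?_⟩
  obtain ⟨C, hC⟩ := hg.bounded
  refine ⟨‖((Real.sqrt N)⁻¹ : ℂ)‖ * C, fun z => ?_⟩
  rw [branchFun, norm_mul]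
  exact mul_le_mul_of_nonneg_left (hC _) (norm_nonneg _)

/-- A system of filters `m_0, …, m_{N-1}` on the circle. -/
structure FilterBank (N : ℕ) where
  toFun : Fin N → Circle → ℂ
  isBddBorel : ∀ i, IsBddBorel (toFun i)

/-- The loop matrix `A_{k,l}(z) = (1/N) ∑_{w ^ N = z} w ^ (-l) m_k(w)`, for `0 ≤ k, l < N`. -/
def loopMatrix (m : FilterBank N) (z : Circle) : Matrix (Fin N) (Fin N) ℂ :=
  Matrix.of fun k l =>
    (1 / N : ℂ) * ∑ᶠ (w : Circle) (_ : w ^ N = z), ((w ^ (l : ℕ))⁻¹ : Circle) * m.toFun k w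

variable [NeZero N]

theorem rootBranch_pow (z : Circle) : rootBranch N z ^ N = z := by
  have hN : (N : ℝ) ≠ 0 := by exact_mod_cast NeZero.ne N
  rw [rootBranch, ← Circle.exp_nsmul]
  simp [mul_div_cancel₀ _ hN]

theorem measurePreserving_pow (N : ℕ) [NeZero N] :
    MeasurePreserving (fun z : Circle => z ^ N) haarCircle haarCircle := by
  have := (powMonoidHom N : Circle →* Circle).measurePreserving (μ := haarCircle)
    (ν := haarCircle) (continuous_pow N)
    (fun z => ⟨rootBranch N z, by simpa using rootBranch_pow z⟩) rfl
  exact this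

/-- The composition operator `f ↦ f(z ^ N)` on `L²(𝕋)`. -/
def powOp (N : ℕ) [NeZero N] : L2Circle →L[ℂ] L2Circle :=
  (Lp.compMeasurePreservingₗᵢ ℂ (fun z : Circle => z ^ N)
    (measurePreserving_pow N)).toContinuousLinearMap

theorem powOp_ae (f : L2Circle) :
    powOp N f =ᵐ[haarCircle] fun z => f (z ^ N) :=
  Lp.coeFn_compMeasurePreserving f (measurePreserving_pow N)

/-- The operators `(S_i f)(z) = m_i(z) f(z ^ N)` on `L²(𝕋)`. -/
def waveletOp (m : FilterBank N) (i : Fin N) : L2Circle →L[ℂ] L2Circle :=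
  (mulOp (m.toFun i) (m.isBddBorel i)).comp (powOp N)

/-- The matrix `𝐒 = (S S̃)`, a row `H^{2N} → H` of operators, as an operator on `H^{2N} ⊕ H`
(it vanishes on the summand `H`). -/
def rowOp (m m' : FilterBank N) :
    Matrix ((Fin N ⊕ Fin N) ⊕ Unit) ((Fin N ⊕ Fin N) ⊕ Unit) (L2Circle →L[ℂ] L2Circle) :=
  Matrix.fromBlocks 0 0 (Matrix.of fun _ => Sum.elim (waveletOp m) (waveletOp m')) 0

/-- The operator matrix `P = 𝐒* 𝐒 + 𝐒 𝐒*`. -/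
def waveletP (m m' : FilterBank N) :
    Matrix ((Fin N ⊕ Fin N) ⊕ Unit) ((Fin N ⊕ Fin N) ⊕ Unit) (L2Circle →L[ℂ] L2Circle) :=
  (rowOp m m')ᴴ * rowOp m m' + rowOp m m' * (rowOp m m')ᴴ

/-- The `2N × 2N` matrix of `P`, i.e. its block on `H^{2N}`. -/
def fockMatrix (m m' : FilterBank N) :
    Matrix (Fin N ⊕ Fin N) (Fin N ⊕ Fin N) (L2Circle →L[ℂ] L2Circle) :=
  (waveletP m m').toBlocks₁₁

theorem fockMatrix_apply (m m' : FilterBank N) (i j : Fin N ⊕ Fin N) :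
    fockMatrix m m' i j = star (Sum.elim (waveletOp m) (waveletOp m') i) *
      Sum.elim (waveletOp m) (waveletOp m') j := by
  simp [fockMatrix, waveletP, rowOp, Matrix.fromBlocks_conjTranspose, Matrix.fromBlocks_multiply,
    Matrix.mul_apply, Matrix.toBlocks₁₁]

theorem rootUnity_pow : rootUnity N ^ N = 1 := by
  have hN : (N : ℝ) ≠ 0 := by exact_mod_cast NeZero.ne N
  rw [rootUnity, ← Circle.exp_nsmul]
  simp [mul_div_cancel₀ _ hN]

theorem exists_rootUnity_pow (z : Circle) (hz : z ^ N = 1) : ∃ j : ℕ, z = rootUnity N ^ j := by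
  obtain ⟨j, -, hj⟩ := (Complex.isPrimitiveRoot_exp N (NeZero.ne N)).eq_pow_of_pow_eq_one
    (ξ := (z : ℂ)) (by exact_mod_cast congrArg (fun z : Circle => (z : ℂ)) hz)
  refine ⟨j, Circle.ext ?_⟩
  rw [← hj, rootUnity, Circle.coe_pow, Circle.coe_exp]
  congr 2
  push_cast
  ring

theorem exists_rootBranch (z : Circle) : ∃ j : ℕ, z = rootUnity N ^ j * rootBranch N (z ^ N) := by
  obtain ⟨j, hj⟩ := exists_rootUnity_pow (N := N) (z * (rootBranch N (z ^ N))⁻¹)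
    (by simp [mul_pow, rootBranch_pow])
  exact ⟨j, by rw [← hj]; simp⟩

theorem sum_rootUnity_shift (F : Circle → ℂ) (j : ℕ) (z : Circle) :
    ∑ k ∈ Finset.range N, F (rootUnity N ^ k * (rootUnity N ^ j * z))
      = ∑ k ∈ Finset.range N, F (rootUnity N ^ k * z) := by
  induction j with
  | zero => simp
  | succ j ih =>
    rw [← ih]
    have h1 := Finset.sum_range_succ (fun k => F (rootUnity N ^ k * (rootUnity N ^ j * z))) N
    have h2 := Finset.sum_range_succ' (fun k => F (rootUnity N ^ k * (rootUnity N ^ j * z))) N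
    rw [h1] at h2
    simp only [rootUnity_pow, pow_zero, add_left_inj] at h2
    rw [h2]
    refine Finset.sum_congr rfl fun k _ => ?_
    congr 1
    rw [pow_succ, pow_succ]
    simp only [mul_assoc, mul_left_comm, mul_comm]

/-- Averaging over the fibres of `z ↦ z ^ N` preserves the integral. -/
theorem integral_fibre (F : Circle → ℂ) (hm : Measurable F) (hF : Integrable F haarCircle) :
    ∫ z, F z ∂haarCircle
      = ∫ z, (1 / N : ℂ) * ∑ k ∈ Finset.range N, F (rootUnity N ^ k * rootBranch N z)
        ∂haarCircle := by
  have hN : (N : ℂ) ≠ 0 := by exact_mod_cast NeZero.ne N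
  set g : Circle → ℂ := fun z =>
    (1 / N : ℂ) * ∑ k ∈ Finset.range N, F (rootUnity N ^ k * rootBranch N z) with hg
  have hgm : Measurable g := by
    refine (Finset.measurable_sum _ fun k _ => hm.comp ?_).const_mul _
    exact (measurable_rootBranch N).const_mul _
  have h1 : ∫ z, g z ∂haarCircle = ∫ z, g (z ^ N) ∂haarCircle := by
    conv_lhs => rw [← (measurePreserving_pow N).map_eq]
    exact integral_map (measurePreserving_pow N).measurable.aemeasurable
      hgm.aestronglyMeasurable
  rw [h1]
  have h2 : ∀ z, g (z ^ N) = (1 / N : ℂ) * ∑ k ∈ Finset.range N, F (rootUnity N ^ k * z) := by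
    intro z
    obtain ⟨j, hj⟩ := exists_rootBranch (N := N) z
    simp only [hg]
    conv_rhs => rw [hj]
    rw [sum_rootUnity_shift]
  simp only [h2]
  rw [integral_const_mul, integral_finsetSum]
  · simp [integral_mul_left_eq_self, hN]
  · intro k _
    exact hF.comp_mul_left _

theorem IsBddBorel.conj {g : Circle → ℂ} (hg : IsBddBorel g) :
    IsBddBorel (fun z => conj (g z)) :=
  ⟨Complex.continuous_conj.measurable.comp hg.measurable, by simpa using hg.bounded⟩

theorem star_mulOp {g : Circle → ℂ} (hg : IsBddBorel g) :
    star (mulOp g hg) = mulOp (fun z => conj (g z)) hg.conj := by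
  rw [ContinuousLinearMap.star_eq_adjoint, eq_comm, ContinuousLinearMap.eq_adjoint_iff]
  intro x y
  rw [L2.inner_def, L2.inner_def]
  refine integral_congr_ae ?_
  filter_upwards [mulOp_ae _ hg.conj x, mulOp_ae _ hg y] with z h1 h2
  rw [h1, h2]
  simp
  ring

theorem commute_mulOp {g g' : Circle → ℂ} (hg : IsBddBorel g) (hg' : IsBddBorel g') :
    Commute (mulOp g hg) (mulOp g' hg') := by
  refine ContinuousLinearMap.ext fun f => Lp.ext ?_
  change mulOp g hg (mulOp g' hg' f) =ᵐ[haarCircle] mulOp g' hg' (mulOp g hg f)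
  filter_upwards [mulOp_ae _ hg (mulOp g' hg' f), mulOp_ae _ hg' f, mulOp_ae _ hg f,
    mulOp_ae _ hg' (mulOp g hg f)] with z h1 h2 h3 h4
  rw [h1, h2, h4, h3]
  ring

theorem waveletOp_star_mul {g g' : Circle → ℂ} (hg : IsBddBorel g) (hg' : IsBddBorel g') :
    star ((mulOp g hg).comp (powOp N)) * (mulOp g' hg').comp (powOp N)
      = ∑ k, star (mulOp _ (isBddBorel_branchFun (N := N) hg k))
          * mulOp _ (isBddBorel_branchFun (N := N) hg' k) := by
  refine ContinuousLinearMap.ext fun f => ext_inner_left ℂ fun e => ?_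
  have hN : (N : ℂ) ≠ 0 := by exact_mod_cast NeZero.ne N
  have key : ∀ (T T' : L2Circle →L[ℂ] L2Circle), inner ℂ e ((star T * T') f)
      = inner ℂ (T e) (T' f) := by
    intro T T'
    rw [mul_apply_eq_comp, ContinuousLinearMap.star_eq_adjoint,
      ContinuousLinearMap.adjoint_inner_right]
  rw [key, sum_apply, inner_sum]
  simp only [key]
  set F : Circle → ℂ := fun z => inner ℂ (g z * e (z ^ N)) (g' z * f (z ^ N)) with hF
  have hFm : Measurable F := by
    have hp : Measurable fun z : Circle => z ^ N := (measurePreserving_pow N).measurable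
    have he : Measurable e := (Lp.stronglyMeasurable e).measurable
    have hf : Measurable f := (Lp.stronglyMeasurable f).measurable
    exact (hg.measurable.mul (he.comp hp)).inner (hg'.measurable.mul (hf.comp hp))
  have hae : ∀ {g : Circle → ℂ} (hg : IsBddBorel g) (e : L2Circle),
      (mulOp g hg).comp (powOp N) e =ᵐ[haarCircle] fun z => g z * e (z ^ N) := by
    intro g hg e
    filter_upwards [mulOp_ae g hg (powOp N e), powOp_ae (N := N) e] with z h1 h2
    rw [← h2, ← h1]
    rfl
  have h1 : (fun z => inner ℂ ((mulOp g hg).comp (powOp N) e z)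
      ((mulOp g' hg').comp (powOp N) f z)) =ᵐ[haarCircle] F := by
    filter_upwards [hae hg e, hae hg' f] with z h1 h2
    rw [h1, h2]
  have hFi : Integrable F haarCircle := (L2.integrable_inner _ _).congr h1
  rw [L2.inner_def, integral_congr_ae h1, integral_fibre (N := N) F hFm hFi]
  simp only [L2.inner_def]
  rw [← integral_finsetSum _ fun k _ => L2.integrable_inner _ _]
  refine integral_congr_ae ?_
  have h2 : ∀ᵐ z ∂haarCircle, ∀ k : Fin N,
      mulOp _ (isBddBorel_branchFun (N := N) hg k) e z = branchFun N g k z * e z :=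
    ae_all_iff.2 fun k => mulOp_ae _ _ _
  have h3 : ∀ᵐ z ∂haarCircle, ∀ k : Fin N,
      mulOp _ (isBddBorel_branchFun (N := N) hg' k) f z = branchFun N g' k z * f z :=
    ae_all_iff.2 fun k => mulOp_ae _ _ _
  filter_upwards [h2, h3] with z h2 h3
  simp only [h2, h3]
  rw [Finset.sum_range, Finset.mul_sum]
  refine Finset.sum_congr rfl fun k _ => ?_
  have hz : (rootUnity N ^ (k : ℕ) * rootBranch N z) ^ N = z := by
    rw [mul_pow, rootBranch_pow, pow_right_comm, rootUnity_pow, one_pow, one_mul]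
  have hs : ((Real.sqrt N : ℂ))⁻¹ * ((Real.sqrt N : ℂ))⁻¹ = 1 / N := by
    rw [← mul_inv, ← Complex.ofReal_mul, Real.mul_self_sqrt (Nat.cast_nonneg N)]
    simp
  simp only [hF, hz, branchFun, RCLike.inner_apply, map_mul, map_inv₀, Complex.conj_ofReal, ← hs]
  ring

theorem isFockMatrix_fockMatrix (m m' : FilterBank N) : IsFockMatrix (fockMatrix m m') := by
  have hB : ∀ i, IsBddBorel (Sum.elim m.toFun m'.toFun i) := by
    rintro (i | i)
    · exact m.isBddBorel i
    · exact m'.isBddBorel i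
  refine isFockMatrix_of_factor (κ := Fin N)
    (C := fun i l => mulOp _ (isBddBorel_branchFun (N := N) (hB i) l)) ?_ ?_ ?_
  · intro i l j m
    exact commute_mulOp _ _
  · intro i l j m
    rw [star_mulOp]
    exact commute_mulOp _ _
  · intro i j
    rw [fockMatrix_apply, ← waveletOp_star_mul (hB i) (hB j)]
    rcases i with i | i <;> rcases j with j | j <;> rfl

/-- The Fock space `F_{2N}(H, P)`, `H = L²(𝕋)`, with letters `1, …, N, 1̃, …, Ñ`. -/
abbrev WaveletFockSpace (m m' : FilterBank N) : Type :=
  FockSpace (fockMatrix m m') (isFockMatrix_fockMatrix m m')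

/-- The vector `w ⊗ h` of `F_{2N}(H, P)`. -/
def waveletVec (m m' : FilterBank N) (w : List (Fin N ⊕ Fin N)) (h : L2Circle) :
    WaveletFockSpace m m' :=
  fockVec (isFockMatrix_fockMatrix m m') w h

/-- The copy of `h ∈ H` in the vacuum sector of `F_{2N}(H, P)`. -/
def waveletVac (m m' : FilterBank N) (h : L2Circle) : WaveletFockSpace m m' :=
  waveletVec m m' [] h

/-- The creation operators on `F_{2N}(H, P)`. -/
def waveletCreation (m m' : FilterBank N) (i : Fin N ⊕ Fin N) :
    WaveletFockSpace m m' →L[ℂ] WaveletFockSpace m m' :=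
  creation (isFockMatrix_fockMatrix m m') i

/-- The creation operators `T_1, …, T_N`. -/
def opT (m m' : FilterBank N) (i : Fin N) : WaveletFockSpace m m' →L[ℂ] WaveletFockSpace m m' :=
  waveletCreation m m' (Sum.inl i)

/-- The creation operators `T̃_1, …, T̃_N`. -/
def opT' (m m' : FilterBank N) (i : Fin N) : WaveletFockSpace m m' →L[ℂ] WaveletFockSpace m m' :=
  waveletCreation m m' (Sum.inr i)

/-- The `*`-algebra generated by `T̃_1, …, T̃_N`. -/
def algT' (m m' : FilterBank N) :
    StarSubalgebra ℂ (WaveletFockSpace m m' →L[ℂ] WaveletFockSpace m m') :=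
  StarAlgebra.adjoin ℂ (Set.range (opT' m m'))

end Wavelet
end
end WaveletFock

open WaveletFock

/-! Over each `z` the fibre of `w ↦ w ^ N` has `N` points. Evaluating the filters there, scaled by
`N^(-1/2)`, gives multiplication operators `C a l` with `P a b = ∑ l, star (C a l) * C b l`
(`fockMatrix_eq_sum_branchOp`). All of these operators and their adjoints commute. The factorization
lets a first letter be stripped from the Fock form (`fockForm_peel`), which bounds the creation
operators (`norm_prependLetter_le`). Commutativity makes `star T_a * T_b` act by `w ⊗ h ↦ w ⊗ P a b
h` on every word, not only on the vacuum (`star_creation_creation`).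

The loop matrix differs from the matrix of scaled fibre values by a unitary Fourier factor, so the
entries of `P` are entries of products such as `A Aᴴ` and `A Ãᴴ` (`loopMatrix_mul_conjTranspose`).
Biorthogonality says `Aᴴ Ã = 1`, hence also `A Ãᴴ = 1`, and therefore `star T̃_j * T_i = δ` on the
whole Fock space. Since annihilators kill the vacuum, the fermionic relation there follows.

For membership in the closed algebra, let `Q` and `K` be the Gram matrices of the `T̃_i` and of the
`T_i`. The relation `T_i = ∑ j, T̃_j K_ji` (`opT_eq_sum`) gives `Q K = 1`. A closed `*`-subalgebra
is closed under inverses and inverse square roots of positive invertible elements, so `K` and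
`Q^(-1/2)` have entries in the norm closure of `𝔄`. Thus the `T_i` lie there, and so do the
isometries `W = T̃ Q^(-1/2)`. Their adjoints annihilate the vacuum, so their ranges do not fill the
space. -/

namespace WaveletFock

/-! ### Gram matrices over a C*-algebra and orthonormalization -/

section StarAlgebra

/-- The inverse and an inverse square root of an invertible `star X * X` lie in each closed
`*`-subalgebra that contains it. -/
theorem exists_inverse_sqrt_mem {M : Type*} [CStarAlgebra M] (S : StarSubalgebra ℂ M)
    (hS : IsClosed (S : Set M)) (X Q K : M) (hX : star X * X = Q) (hQK : Q * K = 1)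
    (hKQ : K * Q = 1) (hQS : Q ∈ S) : K ∈ S ∧ ∃ R ∈ S, star R * Q * R = 1 := by
  have := hS
  have hQs : IsSelfAdjoint Q := hX ▸ IsSelfAdjoint.star_mul_self X
  have hQu : IsUnit Q := ⟨⟨Q, K, hQK, hKQ⟩, rfl⟩
  -- Positivity comes from the factorization through `X`; invertibility excludes `0`. Both functions
  -- used below are then continuous on the spectrum.
  have hspec : ∀ x ∈ spectrum ℝ Q, 0 < x := fun x hx =>
    lt_of_le_of_ne (spectrum_star_mul_self_nonneg (b := X) x (by rwa [hX]))
      fun h => (spectrum.zero_notMem_iff ℝ).2 hQu (h ▸ hx)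
  have hinv : ContinuousOn (fun x : ℝ => x⁻¹) (spectrum ℝ Q) :=
    continuousOn_inv₀.mono fun x hx => (hspec x hx).ne'
  have hsq : ContinuousOn (fun x : ℝ => (√x)⁻¹) (spectrum ℝ Q) :=
    Real.continuous_sqrt.continuousOn.inv₀ fun x hx => (Real.sqrt_pos.2 (hspec x hx)).ne'
  constructor
  · have h1 : Q * cfc (fun x : ℝ => x⁻¹) Q = 1 := by
      nth_rw 1 [← cfc_id' ℝ Q]
      rw [← cfc_mul _ _ Q, ← cfc_one ℝ Q]
      exact cfc_congr fun x hx => mul_inv_cancel₀ (hspec x hx).ne'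
    -- Inverses are unique, so the given `K` is the one produced by the functional calculus, which
    -- stays inside `S`.
    have h2 : K = cfc (fun x : ℝ => x⁻¹) Q := by
      calc K = K * (Q * cfc (fun x : ℝ => x⁻¹) Q) := by rw [h1, mul_one]
        _ = _ := by rw [← mul_assoc, hKQ, one_mul]
    rw [h2]
    exact cfc_mem _ hQS
  · refine ⟨cfc (fun x : ℝ => (√x)⁻¹) Q, cfc_mem _ hQS, ?_⟩
    rw [(cfc_predicate (fun x : ℝ => (√x)⁻¹) Q : IsSelfAdjoint _).star_eq]
    have h2 : cfc (fun x : ℝ => (√x)⁻¹) Q * Q * cfc (fun x : ℝ => (√x)⁻¹) Q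
        = cfc (fun x : ℝ => (√x)⁻¹ * x * (√x)⁻¹) Q := by
      rw [cfc_mul (fun x : ℝ => (√x)⁻¹ * x) (fun x : ℝ => (√x)⁻¹) Q
        (hsq.mul continuousOn_id) hsq, cfc_mul (fun x : ℝ => (√x)⁻¹) (fun x : ℝ => x) Q hsq
        continuousOn_id, cfc_id' ℝ Q]
    rw [h2, ← cfc_one ℝ Q]
    refine cfc_congr fun x hx => ?_
    have h0 := (Real.sqrt_pos.2 (hspec x hx)).ne'
    have h1 := Real.sq_sqrt (hspec x hx).le
    simp only [Pi.one_apply]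
    field_simp
    exact h1.symm

variable {n A : Type*} [Fintype n] [DecidableEq n] [CStarAlgebra A]

/-- The matrices with entries in a `*`-subalgebra. -/
def matrixStarSubalgebra (n : Type*) [Fintype n] [DecidableEq n] (B : StarSubalgebra ℂ A) :
    StarSubalgebra ℂ (CStarMatrix n n A) where
  carrier := {M | ∀ i j, M i j ∈ B}
  mul_mem' := fun {M M'} hM hM' i j => by
    rw [CStarMatrix.mul_apply]
    exact sum_mem fun k _ => mul_mem (hM i k) (hM' k j)
  add_mem' := fun {M M'} hM hM' i j => add_mem (hM i j) (hM' i j)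
  algebraMap_mem' := fun r i j => by
    rw [CStarMatrix.algebraMap_apply]
    split_ifs
    · exact algebraMap_mem B r
    · exact zero_mem B
  star_mem' := fun {M} hM i j => by
    rw [CStarMatrix.star_apply]
    exact star_mem (hM j i)

theorem isClosed_matrixStarSubalgebra (B : StarSubalgebra ℂ A) (hB : IsClosed (B : Set A)) :
    IsClosed (matrixStarSubalgebra n B : Set (CStarMatrix n n A)) := by
  have : (matrixStarSubalgebra n B : Set (CStarMatrix n n A))
      -- The topology of `CStarMatrix` is the entrywise one, so closedness can be tested entry by
      -- entry.
      = ⋂ i, ⋂ j, (fun M : Matrix n n A => M i j) ⁻¹' (B : Set A) := by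
    exact Set.ext fun M => ⟨fun h => Set.mem_iInter.2 fun i => Set.mem_iInter.2 fun j => h i j,
      fun h i j => Set.mem_iInter.1 (Set.mem_iInter.1 h i) j⟩
  rw [this]
  exact isClosed_iInter fun i => isClosed_iInter fun j =>
    hB.preimage (f := fun M : Matrix n n A => M i j) (continuous_apply_apply i j)

/-- Put the tuple in a single row and zeros elsewhere. This supplies the positivity of Gram matrices
that `exists_inverse_sqrt_mem` asks for. -/
theorem exists_star_mul_self_eq_gram (t : n → A) : ∃ X : CStarMatrix n n A,
    star X * X = CStarMatrix.ofMatrix fun i j => star (t i) * t j := by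
  rcases isEmpty_or_nonempty n with h | ⟨⟨i₀⟩⟩
  · exact ⟨0, CStarMatrix.ext fun i => h.elim i⟩
  · refine ⟨CStarMatrix.ofMatrix fun i j => if i = i₀ then t j else 0,
      CStarMatrix.ext fun i j => ?_⟩
    rw [CStarMatrix.mul_apply, Finset.sum_eq_single i₀]
    · change star (if i₀ = i₀ then t i else 0) * (if i₀ = i₀ then t j else 0) = star (t i) * t j
      simp
    · intro k _ hk
      change star (if k = i₀ then t i else 0) * (if k = i₀ then t j else 0) = 0
      simp [hk]
    · simp

variable [PartialOrder A] [StarOrderedRing A]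

/-- Two biorthogonal tuples `t`, `t'` with the same right span: `t` lies in each closed
`*`-subalgebra that contains `t'`, and so does an orthonormalization of `t'`. -/
theorem exists_orthonormalization (B : StarSubalgebra ℂ A) (hB : IsClosed (B : Set A))
    (t t' : n → A) (ht' : ∀ i, t' i ∈ B)
    (hbi : ∀ i j, star (t' j) * t i = if i = j then 1 else 0)
    (hspan : ∀ i, t i = ∑ j, t' j * (star (t j) * t i)) :
    (∀ i, t i ∈ B) ∧ ∃ R : n → n → A, (∀ i, ∑ j, t' j * R j i ∈ B) ∧
      ∀ i j, star (∑ k, t' k * R k i) * (∑ k, t' k * R k j) = if i = j then 1 else 0 := by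
  set Q : CStarMatrix n n A := CStarMatrix.ofMatrix fun i j => star (t' i) * t' j with hQ
  set K : CStarMatrix n n A := CStarMatrix.ofMatrix fun i j => star (t i) * t j with hK
  have hQij : ∀ i j, Q i j = star (t' i) * t' j := fun _ _ => rfl
  have hKij : ∀ i j, K i j = star (t i) * t j := fun _ _ => rfl
  have hQB : Q ∈ matrixStarSubalgebra n B := fun i j => mul_mem (star_mem (ht' i)) (ht' j)
  obtain ⟨X, hX⟩ := exists_star_mul_self_eq_gram t'
  obtain ⟨Y, hY⟩ := exists_star_mul_self_eq_gram t
  have hQK : Q * K = 1 := by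
    refine CStarMatrix.ext fun i j => ?_
    have h1 : star (t' i) * t j = (Q * K) i j := by
      -- The span relation turns the mixed Gram matrix into `Q * K`; biorthogonality says that it is
      -- the identity.
      conv_lhs => rw [hspan j]
      simp only [CStarMatrix.mul_apply, Finset.mul_sum, mul_assoc, hQij, hKij]
    rw [← h1, hbi, CStarMatrix.one_apply]
    simp only [eq_comm]
  have hQs : star Q = Q := by rw [hQ, ← hX, star_mul, star_star]
  have hKs : star K = K := by rw [hK, ← hY, star_mul, star_star]
  -- Both Gram matrices are self-adjoint, so the other product is the adjoint of the first.
  have hKQ : K * Q = 1 := by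
    have := congrArg star hQK
    rwa [star_mul, star_one, hQs, hKs] at this
  obtain ⟨hKB, R, hRB, hR⟩ := exists_inverse_sqrt_mem (matrixStarSubalgebra n B)
    (isClosed_matrixStarSubalgebra B hB) X Q K hX hQK hKQ hQB
  refine ⟨fun i => ?_, fun i j => R i j,
    fun i => sum_mem fun j _ => mul_mem (ht' j) (hRB j i), fun i j => ?_⟩
  · rw [hspan i]
    exact sum_mem fun j _ => mul_mem (ht' j) (hKB j i)
  · have h1 := congrFun (congrFun hR i) j
    rw [CStarMatrix.one_apply] at h1
    rw [← h1]
    simp only [CStarMatrix.mul_apply, CStarMatrix.star_apply, star_sum, star_mul, Finset.sum_mul,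
      Finset.mul_sum, hQij, mul_assoc]

end StarAlgebra

/-! ### Fock spaces of operator matrices -/

section Fock

variable {ι κ H : Type*} [NormedAddCommGroup H] [InnerProductSpace ℂ H]

section PreFock

variable {P : Matrix ι ι (H →L[ℂ] H)} (hP : IsFockMatrix P)

theorem norm_sq_preFock (x : PreFock P hP) : ‖x‖ ^ 2 = (fockForm P x x).re :=
  norm_sq_eq_re_inner (𝕜 := ℂ) x

theorem inner_toFock (x y : PreFock P hP) :
    inner ℂ (toFock hP x) (toFock hP y) = fockForm P x y :=
  UniformSpace.Completion.inner_coe x y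

theorem norm_toFock (x : PreFock P hP) : ‖toFock hP x‖ = ‖x‖ :=
  UniformSpace.Completion.norm_coe x

theorem denseRange_toFock : DenseRange (toFock hP) :=
  UniformSpace.Completion.denseRange_coe

theorem inner_fockVec (w v : List ι) (h k : H) :
    inner ℂ (fockVec hP w h) (fockVec hP v k) = inner ℂ h (wordEntry P w v k) := by
  exact (inner_toFock hP _ _).trans (fockForm_single P w v h k)

theorem toFock_mem_span (x : PreFock P hP) :
    toFock hP x ∈ Submodule.span ℂ {ψ | ∃ w h, ψ = fockVec hP w h} := by
  induction x using Finsupp.induction_linear with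
  | zero => exact (congrArg (· ∈ _) (map_zero (toFock hP))).mpr (zero_mem _)
  | add x y hx hy => exact (congrArg (· ∈ _) (map_add (toFock hP) x y)).mpr (add_mem hx hy)
  | single w h => exact Submodule.subset_span ⟨w, h, rfl⟩

theorem dense_span_fockVec :
    Dense (Submodule.span ℂ {ψ | ∃ w h, ψ = fockVec hP w h} : Set (FockSpace P hP)) :=
  (denseRange_toFock hP).mono (by rintro _ ⟨x, rfl⟩; exact toFock_mem_span hP x)

theorem ext_fockVec {F : Type*} [NormedAddCommGroup F] [NormedSpace ℂ F]
    {S T : FockSpace P hP →L[ℂ] F} (h : ∀ w a, S (fockVec hP w a) = T (fockVec hP w a)) :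
    S = T :=
  ContinuousLinearMap.ext_on (dense_span_fockVec hP) (by rintro _ ⟨w, a, rfl⟩; exact h w a)

theorem eq_of_inner_fockVec {ψ φ : FockSpace P hP}
    (h : ∀ w a, inner ℂ (fockVec hP w a) ψ = inner ℂ (fockVec hP w a) φ) : ψ = φ := by
  have h1 : innerSL ℂ ψ = innerSL ℂ φ := ext_fockVec hP fun w a => by
    rw [innerSL_apply_apply, innerSL_apply_apply, ← inner_conj_symm, h, inner_conj_symm]
  refine ext_inner_right ℂ fun x => ?_
  simpa using congrArg (fun T : FockSpace P hP →L[ℂ] ℂ => T x) h1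

end PreFock

/-! ### Boundedness of creation operators from a commuting factorization -/

section Amplification

variable {C : ι → κ → (H →L[ℂ] H)} {P : Matrix ι ι (H →L[ℂ] H)}

/-- The operator `w ⊗ h ↦ w ⊗ D h` on finite sums. -/
noncomputable def amplify (D : H →L[ℂ] H) (x : List ι →₀ H) : List ι →₀ H :=
  x.mapRange D (map_zero D)

theorem peel_amplify (D : H →L[ℂ] H) (hD : ∀ i l, Commute D (C i l)) (l : κ) (x : List ι →₀ H) :
    peel C l (amplify D x) = amplify D (peel C l x) := by
  induction x using Finsupp.induction_linear with
  | zero => simp [amplify, peel_zero]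
  | add x y hx hy =>
    simp only [amplify, peel_add, Finsupp.mapRange_add (map_add D)] at hx hy ⊢
    rw [hx, hy]
  | single w h =>
    rcases w with _ | ⟨i, w⟩
    · simp [amplify, peel_nil]
    · simp only [amplify, Finsupp.mapRange_single, peel_cons]
      exact congrArg _ (congrArg (fun T : H →L[ℂ] H => T h) (hD i l).symm.eq)

/-- Stripping the letter just created leaves only its weight, which reduces bounding a creation
operator to bounding amplifications. -/
theorem peel_prepend (C : ι → κ → (H →L[ℂ] H)) (i : ι) (l : κ) (x : List ι →₀ H) :
    peel C l (x.mapDomain (List.cons i)) = amplify (C i l) x := by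
  induction x using Finsupp.induction_linear with
  | zero => simp [amplify, peel_zero]
  | add x y hx hy =>
    rw [Finsupp.mapDomain_add, peel_add, hx, hy]
    exact (Finsupp.mapRange_add (map_add (C i l)) x y).symm
  | single w h => simp [amplify, Finsupp.mapDomain_single, peel_cons]

variable [CompleteSpace H] [Fintype κ]

/-- `D` commutes with the weights, so amplification passes through `peel`. Induction on word length
then leaves only the vacuum components, where the operator norm of `D` gives the bound. -/
theorem fockForm_amplify_le (hPC : ∀ i j i' l, Commute (P i j) (C i' l))
    (h : ∀ i j, P i j = ∑ l, star (C i l) * C j l) (D : H →L[ℂ] H)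
    (hD : ∀ i l, Commute D (C i l)) (x : List ι →₀ H) :
    (fockForm P (amplify D x) (amplify D x)).re ≤ ‖D‖ ^ 2 * (fockForm P x x).re := by
  suffices H : ∀ (n : ℕ) (x : List ι →₀ H), (∀ w, x w ≠ 0 → w.length < n) →
      (fockForm P (amplify D x) (amplify D x)).re ≤ ‖D‖ ^ 2 * (fockForm P x x).re by
    refine H (x.support.sup List.length + 1) x fun w hw => Nat.lt_succ_of_le ?_
    exact Finset.le_sup (f := List.length) (by simpa using hw)
  intro n
  induction n with
  | zero =>
    intro x hx
    have : x = 0 := by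
      ext w
      by_contra hw
      exact absurd (hx w hw) (by simp)
    simp [this, amplify, fockForm_zero_left]
  | succ n ih =>
    intro x hx
    rw [fockForm_peel hPC h, fockForm_peel hPC h x x]
    simp only [Complex.add_re, Complex.re_sum, mul_add, Finset.mul_sum]
    refine add_le_add ?_ (Finset.sum_le_sum fun l _ => ?_)
    · have h1 : ∀ a : H, (inner ℂ a a).re = ‖a‖ ^ 2 := fun a =>
        (norm_sq_eq_re_inner (𝕜 := ℂ) a).symm
      rw [h1, h1, ← mul_pow]
      refine pow_le_pow_left₀ (norm_nonneg _) ?_ 2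
      rw [amplify, Finsupp.mapRange_apply]
      exact D.le_opNorm _
    · rw [peel_amplify D hD]
      refine ih _ fun v hv => ?_
      obtain ⟨i, hi⟩ := peel_ne_zero C l x v hv
      simpa using hx _ hi

/-- A vector whose words all begin with `i` has no vacuum component; its peelings are the
amplifications by the `C i l`, each bounded by `‖C i l‖ ^ 2`. -/
theorem fockForm_prepend_le
    (hCC : ∀ i l j m, Commute (C i l) (C j m)) (hPC : ∀ i j i' l, Commute (P i j) (C i' l))
    (h : ∀ i j, P i j = ∑ l, star (C i l) * C j l) (i : ι) (x : List ι →₀ H) :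
    (fockForm P (x.mapDomain (List.cons i)) (x.mapDomain (List.cons i))).re
      ≤ (∑ l, ‖C i l‖ ^ 2) * (fockForm P x x).re := by
  rw [fockForm_peel hPC h, Finsupp.mapDomain_of_notMem_range _ _ (by simp), inner_zero_left,
    zero_add, Complex.re_sum, Finset.sum_mul]
  simp only [peel_prepend]
  exact Finset.sum_le_sum fun l _ => fockForm_amplify_le hPC h _ (fun j m => hCC _ _ _ _) _

theorem norm_prependLetter_le (hP : IsFockMatrix P)
    (hCC : ∀ i l j m, Commute (C i l) (C j m)) (hPC : ∀ i j i' l, Commute (P i j) (C i' l))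
    (h : ∀ i j, P i j = ∑ l, star (C i l) * C j l) (i : ι) (x : PreFock P hP) :
    ‖prependLetter hP i x‖ ≤ √(∑ l, ‖C i l‖ ^ 2) * ‖x‖ := by
  refine le_of_sq_le_sq ?_ (by positivity)
  rw [mul_pow, Real.sq_sqrt (by positivity), norm_sq_preFock, norm_sq_preFock]
  exact fockForm_prepend_le hCC hPC h i x

theorem creation_fockVec (hP : IsFockMatrix P)
    (hCC : ∀ i l j m, Commute (C i l) (C j m)) (hPC : ∀ i j i' l, Commute (P i j) (C i' l))
    (h : ∀ i j, P i j = ∑ l, star (C i l) * C j l) (i : ι) (w : List ι) (a : H) :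
    creation hP i (fockVec hP w a) = fockVec hP (i :: w) a := by
  refine (LinearMap.extendOfNorm_eq (denseRange_toFock hP) ?_
    (Finsupp.single w a : List ι →₀ H)).trans ?_
  -- The continuous extension agrees with the map on finite sums once a norm bound is known.
  · refine ⟨√(∑ l, ‖C i l‖ ^ 2), fun x => ?_⟩
    rw [LinearMap.comp_apply, norm_toFock, norm_toFock]
    exact norm_prependLetter_le hP hCC hPC h i x
  · exact congrArg (toFock hP) (Finsupp.mapDomain_single (f := List.cons i) (a := w) (b := a))

end Amplification

/-! ### Annihilation operators and the particle grading -/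

section Creation

variable {P : Matrix ι ι (H →L[ℂ] H)} (hP : IsFockMatrix P)

theorem star_creation_vacuum
    (hT : ∀ i w a, creation hP i (fockVec hP w a) = fockVec hP (i :: w) a)
    (i : ι) (a : H) : star (creation hP i) (fockVec hP [] a) = 0 := by
  refine eq_of_inner_fockVec hP fun w b => ?_
  rw [ContinuousLinearMap.star_eq_adjoint, ContinuousLinearMap.adjoint_inner_right, hT,
    inner_fockVec]
  simp [wordEntry]

/-- Pairing with `v ⊗ b` gives `P i j` followed on its right by the word operator; commutativity
moves `P i j` onto `a`, whatever the word `w`. -/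
theorem star_creation_creation
    (hT : ∀ i w a, creation hP i (fockVec hP w a) = fockVec hP (i :: w) a)
    (hcomm : ∀ i j i' j', Commute (P i j) (P i' j')) (i j : ι)
    (w : List ι) (a : H) :
    star (creation hP i) (creation hP j (fockVec hP w a)) = fockVec hP w (P i j a) := by
  refine eq_of_inner_fockVec hP fun v b => ?_
  rw [ContinuousLinearMap.star_eq_adjoint, ContinuousLinearMap.adjoint_inner_right, hT, hT,
    inner_fockVec, inner_fockVec, wordEntry, ← (wordEntry_commute (fun _ _ => hcomm _ _ _ _) v w).eq]
  rfl

theorem map_particleSpace_le (S : FockSpace P hP →L[ℂ] FockSpace P hP) (n : ℕ)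
    (V : Submodule ℂ (FockSpace P hP)) (hV : IsClosed (V : Set (FockSpace P hP)))
    (hS : ∀ (w : List ι) (a : H), w.length = n → S (fockVec hP w a) ∈ V) :
    ∀ ψ ∈ particleSpace hP n, S ψ ∈ V := by
  have h : particleSpace hP n ≤ V.comap S.toLinearMap := by
    refine Submodule.topologicalClosure_minimal _ (Submodule.span_le.2 ?_)
      (hV.preimage S.continuous)
    rintro _ ⟨w, a, hw, rfl⟩
    exact hS w a hw
  exact h

theorem isClosed_particleSpace (n : ℕ) :
    IsClosed (particleSpace hP n : Set (FockSpace P hP)) :=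
  Submodule.isClosed_topologicalClosure _

theorem fockVec_mem_particleSpace (w : List ι) (a : H) :
    fockVec hP w a ∈ particleSpace hP w.length :=
  Submodule.le_topologicalClosure _ (Submodule.subset_span ⟨w, a, rfl, rfl⟩)

theorem creation_mem_particleSpace
    (hT : ∀ i w a, creation hP i (fockVec hP w a) = fockVec hP (i :: w) a)
    (i : ι) (n : ℕ) :
    ∀ ψ ∈ particleSpace hP n, creation hP i ψ ∈ particleSpace hP (n + 1) := by
  refine map_particleSpace_le hP _ n _ (isClosed_particleSpace hP _) fun w a hw => ?_
  rw [hT, ← hw]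
  exact fockVec_mem_particleSpace hP (i :: w) a

theorem star_creation_mem_particleSpace
    (hT : ∀ i w a, creation hP i (fockVec hP w a) = fockVec hP (i :: w) a)
    (hcomm : ∀ i j i' j', Commute (P i j) (P i' j')) (i : ι)
    (n : ℕ) : ∀ ψ ∈ particleSpace hP (n + 1), star (creation hP i) ψ ∈ particleSpace hP n := by
  refine map_particleSpace_le hP _ (n + 1) _ (isClosed_particleSpace hP _) fun w a hw => ?_
  rcases w with _ | ⟨j, w⟩
  · simp at hw
  · rw [← hT, star_creation_creation hP hT hcomm]
    obtain rfl : w.length = n := by simpa using hw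
    exact fockVec_mem_particleSpace hP w _

theorem star_creation_particleSpace_zero
    (hT : ∀ i w a, creation hP i (fockVec hP w a) = fockVec hP (i :: w) a)
    (i : ι) :
    ∀ ψ ∈ particleSpace hP 0, star (creation hP i) ψ = 0 := by
  have h := map_particleSpace_le hP (star (creation hP i)) 0 ⊥ (by simp) fun w a hw => by
    rw [List.length_eq_zero_iff.1 hw, star_creation_vacuum hP hT]
    exact zero_mem _
  simpa using h

end Creation
end Fock

/-! ### Loop matrices and fibres of the power map -/

section LoopMatrix

variable {N : ℕ} [NeZero N]

/-- The `k`-th point of the fibre of `w ↦ w ^ N` over `z`. -/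
noncomputable def fibrePoint (z : Circle) (k : Fin N) : Circle :=
  rootUnity N ^ (k : ℕ) * rootBranch N z

theorem fibrePoint_pow (z : Circle) (k : Fin N) : fibrePoint z k ^ N = z := by
  rw [fibrePoint, mul_pow, rootBranch_pow, pow_right_comm, rootUnity_pow, one_pow, one_mul]

theorem isPrimitiveRoot_rootUnity : IsPrimitiveRoot (rootUnity N) N := by
  refine IsPrimitiveRoot.of_map_of_injective (f := Circle.coeHom) ?_ Circle.coe_injective
  have h : Circle.coeHom (rootUnity N) = Complex.exp (2 * Real.pi * Complex.I / N) := by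
    change ((rootUnity N : Circle) : ℂ) = _
    rw [rootUnity, Circle.coe_exp]
    congr 1
    push_cast
    ring
  rw [h]
  exact Complex.isPrimitiveRoot_exp N (NeZero.ne N)

theorem fibrePoint_injective (z : Circle) : Function.Injective (fibrePoint (N := N) z) := by
  intro k k' h
  exact Fin.ext (isPrimitiveRoot_rootUnity.pow_inj k.2 k'.2 (mul_right_cancel h))

theorem pow_eq_iff_mem_range_fibrePoint (w z : Circle) :
    w ^ N = z ↔ w ∈ Set.range (fibrePoint (N := N) z) := by
  constructor
  · rintro rfl
    obtain ⟨j, hj⟩ := exists_rootBranch (N := N) w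
    -- The exponent `j` is an arbitrary natural number; since the root of unity has order `N`,
    -- reducing modulo `N` does not change its power.
    refine ⟨⟨j % N, Nat.mod_lt _ (NeZero.pos N)⟩, ?_⟩
    have h := pow_mod_orderOf (rootUnity N) j
    rw [← isPrimitiveRoot_rootUnity.eq_orderOf] at h
    rw [fibrePoint, h]
    exact hj.symm
  · rintro ⟨k, rfl⟩
    exact fibrePoint_pow z k

theorem inv_sqrt_mul_self (N : ℕ) : ((Real.sqrt N : ℂ))⁻¹ * ((Real.sqrt N : ℂ))⁻¹ = 1 / N := by
  rw [← mul_inv, ← Complex.ofReal_mul, Real.mul_self_sqrt (Nat.cast_nonneg N)]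
  simp

/-- Splitting `1 / N` into two factors `N^(-1/2)` exhibits the loop matrix as the matrix of branch
functions times a Fourier matrix depending only on `z`. -/
theorem loopMatrix_apply (m : FilterBank N) (z : Circle) (i l : Fin N) :
    loopMatrix m z i l = ∑ k : Fin N, ((Real.sqrt N)⁻¹ : ℂ) *
      conj ((fibrePoint z k : ℂ) ^ (l : ℕ)) * branchFun N (m.toFun i) k z := by
  have h : ∑ᶠ (w : Circle) (_ : w ^ N = z), ((w ^ (l : ℕ))⁻¹ : Circle) * m.toFun i w
      = ∑ k : Fin N, conj ((fibrePoint z k : ℂ) ^ (l : ℕ)) * m.toFun i (fibrePoint z k) := by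
    simp only [pow_eq_iff_mem_range_fibrePoint]
    rw [finsum_mem_range (fibrePoint_injective z), finsum_eq_sum_of_fintype]
    simp only [Circle.coe_inv_eq_conj, Circle.coe_pow]
  rw [loopMatrix, Matrix.of_apply, h, ← inv_sqrt_mul_self N, Finset.mul_sum]
  refine Finset.sum_congr rfl fun k _ => ?_
  rw [branchFun, fibrePoint]
  ring

/-- The quotient of two points of a fibre is an `N`-th root of unity, so this is a geometric sum. It
expresses the unitarity of the Fourier factor. -/
theorem sum_fibrePoint_pow (z : Circle) (k k' : Fin N) :
    ∑ l : Fin N, conj ((fibrePoint z k : ℂ) ^ (l : ℕ)) * (fibrePoint z k' : ℂ) ^ (l : ℕ)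
      = if k = k' then (N : ℂ) else 0 := by
  set x : Circle := (fibrePoint z k)⁻¹ * fibrePoint z k' with hx
  have h1 : ∀ l : ℕ, conj ((fibrePoint z k : ℂ) ^ l) * (fibrePoint z k' : ℂ) ^ l = (x : ℂ) ^ l := by
    intro l
    rw [hx, Circle.coe_mul, Circle.coe_inv_eq_conj, mul_pow, map_pow]
  simp only [h1]
  rw [Fin.sum_univ_eq_sum_range (fun l => (x : ℂ) ^ l)]
  split_ifs with h
  · subst h
    simp [hx]
  · have hx1 : (x : ℂ) ≠ 1 := by
      intro h2
      have : x = 1 := Circle.ext (by simpa using h2)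
      exact h (fibrePoint_injective z (inv_mul_eq_one.1 this))
    have hxN : (x : ℂ) ^ N = 1 := by
      rw [← Circle.coe_pow, hx, mul_pow, inv_pow, fibrePoint_pow, fibrePoint_pow]
      simp
    rw [geom_sum_eq hx1, hxN, sub_self, zero_div]

theorem loopMatrix_mul_conjTranspose (m n : FilterBank N) (z : Circle) (i j : Fin N) :
    (loopMatrix n z * (loopMatrix m z)ᴴ) j i
      = ∑ k : Fin N, conj (branchFun N (m.toFun i) k z) * branchFun N (n.toFun j) k z := by
  have hN : (N : ℂ) ≠ 0 := by exact_mod_cast NeZero.ne N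
  have h1 : ∀ l, loopMatrix n z j l * (loopMatrix m z)ᴴ l i
      = ∑ k : Fin N, ∑ k' : Fin N, branchFun N (n.toFun j) k z * conj (branchFun N (m.toFun i) k' z)
        * (1 / N) * (conj ((fibrePoint z k : ℂ) ^ (l : ℕ)) * (fibrePoint z k' : ℂ) ^ (l : ℕ)) := by
    intro l
    rw [Matrix.conjTranspose_apply, loopMatrix_apply, loopMatrix_apply, star_sum,
      Finset.sum_mul_sum]
    refine Finset.sum_congr rfl fun k _ => Finset.sum_congr rfl fun k' _ => ?_
    simp only [RCLike.star_def, map_mul, Complex.conj_conj, map_inv₀, Complex.conj_ofReal,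
      ← inv_sqrt_mul_self N]
    ring
  simp only [Matrix.mul_apply, h1]
  rw [Finset.sum_comm]
  refine Finset.sum_congr rfl fun k _ => ?_
  rw [Finset.sum_comm]
  simp only [← Finset.mul_sum, sum_fibrePoint_pow]
  rw [Finset.sum_eq_single k]
  · rw [if_pos rfl]
    field_simp
  · intro k' _ hk
    simp [hk.symm]
  · simp

theorem star_waveletOp_waveletOp_ae (m n : FilterBank N) (i j : Fin N) (h : L2Circle) :
    (star (waveletOp m i) * waveletOp n j) h
      =ᵐ[haarCircle] fun z => (loopMatrix n z * (loopMatrix m z)ᴴ) j i * h z := by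
  have hop : star (waveletOp m i) * waveletOp n j
      = ∑ k, star (mulOp _ (isBddBorel_branchFun (N := N) (m.isBddBorel i) k))
          * mulOp _ (isBddBorel_branchFun (N := N) (n.isBddBorel j) k) :=
    waveletOp_star_mul (m.isBddBorel i) (n.isBddBorel j)
  rw [hop, sum_apply]
  refine (Lp.coeFn_finsetSum _ _).trans ?_
  have hk : ∀ᵐ z ∂haarCircle, ∀ k : Fin N,
      (star (mulOp _ (isBddBorel_branchFun (N := N) (m.isBddBorel i) k))
          * mulOp _ (isBddBorel_branchFun (N := N) (n.isBddBorel j) k)) h z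
        = conj (branchFun N (m.toFun i) k z) * branchFun N (n.toFun j) k z * h z := by
    refine ae_all_iff.2 fun k => ?_
    rw [star_mulOp]
    filter_upwards [mulOp_ae _ (isBddBorel_branchFun (N := N) (m.isBddBorel i) k).conj
      (mulOp _ (isBddBorel_branchFun (N := N) (n.isBddBorel j) k) h),
      mulOp_ae _ (isBddBorel_branchFun (N := N) (n.isBddBorel j) k) h] with z h1 h2
    rw [mul_apply_eq_comp, h1, h2, mul_assoc]
  filter_upwards [hk] with z hz
  rw [loopMatrix_mul_conjTranspose, Finset.sum_apply, Finset.sum_mul]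
  exact Finset.sum_congr rfl fun k _ => hz k

/-- Used twice: with `A Ãᴴ = 1` for the mixed relations, and with `Ã Ãᴴ = 1` in the unitary case. -/
theorem star_waveletOp_mul_of_ae (m n : FilterBank N)
    (h : ∀ᵐ z ∂haarCircle, loopMatrix n z * (loopMatrix m z)ᴴ = 1) (i j : Fin N) :
    star (waveletOp m i) * waveletOp n j = if j = i then 1 else 0 := by
  refine ContinuousLinearMap.ext fun f => Lp.ext ?_
  have hr : ((if j = i then 1 else 0 : L2Circle →L[ℂ] L2Circle) f : L2Circle)
      =ᵐ[haarCircle] fun z => (if j = i then 1 else 0 : ℂ) * f z := by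
    split_ifs
    · simp
    · filter_upwards [Lp.coeFn_zero ℂ 2 haarCircle] with z hz
      simp
  filter_upwards [star_waveletOp_waveletOp_ae m n i j f, h, hr] with z h1 h2 h3
  rw [h1, h2, h3, Matrix.one_apply]

/-- The Gram matrices of biorthogonal systems are inverse to each other. -/
theorem sum_star_waveletOp_mul (m m' : FilterBank N)
    (h : ∀ᵐ z ∂haarCircle, (loopMatrix m z)ᴴ * loopMatrix m' z = 1) (i k : Fin N) :
    ∑ j, star (waveletOp m' k) * waveletOp m' j * (star (waveletOp m j) * waveletOp m i)
      = star (waveletOp m' k) * waveletOp m i := by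
  refine ContinuousLinearMap.ext fun f => Lp.ext ?_
  rw [sum_apply]
  refine (Lp.coeFn_finsetSum _ _).trans ?_
  have hj : ∀ᵐ z ∂haarCircle, ∀ j : Fin N,
      (star (waveletOp m' k) * waveletOp m' j * (star (waveletOp m j) * waveletOp m i)) f z
        = (loopMatrix m' z * (loopMatrix m' z)ᴴ) j k
          * ((loopMatrix m z * (loopMatrix m z)ᴴ) i j * f z) := by
    refine ae_all_iff.2 fun j => ?_
    filter_upwards [star_waveletOp_waveletOp_ae m' m' k j
      ((star (waveletOp m j) * waveletOp m i) f), star_waveletOp_waveletOp_ae m m j i f]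
      with z h1 h2
    rw [mul_apply_eq_comp, h1, h2]
  filter_upwards [hj, h, star_waveletOp_waveletOp_ae m' m k i f] with z hz hbi h1
  -- Biorthogonality removes the inner factor `Aᴴ Ã`.
  have hmat : loopMatrix m z * (loopMatrix m' z)ᴴ
      = (loopMatrix m z * (loopMatrix m z)ᴴ) * (loopMatrix m' z * (loopMatrix m' z)ᴴ) := by
    rw [Matrix.mul_assoc, ← Matrix.mul_assoc _ (loopMatrix m' z), hbi, Matrix.one_mul]
  rw [h1, hmat, Matrix.mul_apply, Finset.sum_apply, Finset.sum_mul]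
  refine Finset.sum_congr rfl fun j _ => ?_
  rw [hz j]
  ring

end LoopMatrix

/-! ### The Fock space of two wavelet representations -/

section Wavelet

variable {N : ℕ} (m m' : FilterBank N)

theorem isBddBorel_sumElim (i : Fin N ⊕ Fin N) : IsBddBorel (Sum.elim m.toFun m'.toFun i) := by
  rcases i with i | i
  · exact m.isBddBorel i
  · exact m'.isBddBorel i

/-- The diagonal operators whose Gram matrix is the Fock matrix. -/
noncomputable def branchOp (i : Fin N ⊕ Fin N) (l : Fin N) : L2Circle →L[ℂ] L2Circle :=
  mulOp _ (isBddBorel_branchFun (N := N) (isBddBorel_sumElim m m' i) l)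

theorem commute_branchOp (i : Fin N ⊕ Fin N) (l : Fin N) (j : Fin N ⊕ Fin N) (k : Fin N) :
    Commute (branchOp m m' i l) (branchOp m m' j k) :=
  commute_mulOp _ _

theorem commute_star_branchOp (i : Fin N ⊕ Fin N) (l : Fin N) (j : Fin N ⊕ Fin N) (k : Fin N) :
    Commute (star (branchOp m m' i l)) (branchOp m m' j k) := by
  rw [branchOp, star_mulOp]
  exact commute_mulOp _ _

variable [NeZero N]

theorem fockMatrix_eq_sum_branchOp (i j : Fin N ⊕ Fin N) :
    fockMatrix m m' i j = ∑ l, star (branchOp m m' i l) * branchOp m m' j l := by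
  refine Eq.trans ?_
    (waveletOp_star_mul (N := N) (isBddBorel_sumElim m m' i) (isBddBorel_sumElim m m' j))
  rw [fockMatrix_apply]
  rcases i with i | i <;> rcases j with j | j <;> rfl

theorem commute_fockMatrix_branchOp (i j i' : Fin N ⊕ Fin N) (l : Fin N) :
    Commute (fockMatrix m m' i j) (branchOp m m' i' l) := by
  rw [fockMatrix_eq_sum_branchOp]
  exact Commute.sum_left _ _ _ fun k _ =>
    (commute_star_branchOp m m' _ _ _ _).mul_left (commute_branchOp m m' _ _ _ _)

theorem commute_fockMatrix (i j i' j' : Fin N ⊕ Fin N) :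
    Commute (fockMatrix m m' i j) (fockMatrix m m' i' j') := by
  -- Hermitian symmetry turns commutation with the branch operators into commutation with their
  -- adjoints.
  have hs : star (fockMatrix m m' j i) = fockMatrix m m' i j := by simp [fockMatrix_apply]
  rw [fockMatrix_eq_sum_branchOp m m' i' j']
  refine Commute.sum_right _ _ _ fun k _ =>
    Commute.mul_right ?_ (commute_fockMatrix_branchOp m m' _ _ _ _)
  rw [← hs]
  exact (commute_fockMatrix_branchOp m m' _ _ _ _).star_star

theorem waveletCreation_waveletVec (i : Fin N ⊕ Fin N) (w : List (Fin N ⊕ Fin N))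
    (h : L2Circle) :
    waveletCreation m m' i (waveletVec m m' w h) = waveletVec m m' (i :: w) h :=
  creation_fockVec _ (commute_branchOp m m') (commute_fockMatrix_branchOp m m')
    (fockMatrix_eq_sum_branchOp m m') i w h

theorem star_waveletCreation_waveletCreation (i j : Fin N ⊕ Fin N) (w : List (Fin N ⊕ Fin N))
    (h : L2Circle) :
    star (waveletCreation m m' i) (waveletCreation m m' j (waveletVec m m' w h))
      = waveletVec m m' w (fockMatrix m m' i j h) :=
  star_creation_creation _ (waveletCreation_waveletVec m m') (commute_fockMatrix m m') i j w h

theorem star_waveletCreation_waveletVac (i : Fin N ⊕ Fin N) (h : L2Circle) :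
    star (waveletCreation m m' i) (waveletVac m m' h) = 0 :=
  star_creation_vacuum _ (waveletCreation_waveletVec m m') i h

/-- The vacuum embedding preserves inner products, so the constant function `1` survives the passage
to the quotient. -/
theorem exists_waveletVac_ne_zero : ∃ h : L2Circle, waveletVac m m' h ≠ 0 := by
  have hne : (Lp.const 2 haarCircle (1 : ℂ)) ≠ 0 := by
    have h := Lp.norm_const' (p := 2) (μ := haarCircle) (c := (1 : ℂ)) (by simp) (by simp)
    intro h0
    simp [h0] at h
  refine ⟨Lp.const 2 haarCircle (1 : ℂ), fun h0 => hne ?_⟩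
  have h1 := inner_fockVec (isFockMatrix_fockMatrix m m') [] []
    (Lp.const 2 haarCircle (1 : ℂ)) (Lp.const 2 haarCircle (1 : ℂ))
  have h2 : fockVec (isFockMatrix_fockMatrix m m') [] (Lp.const 2 haarCircle (1 : ℂ)) = 0 := h0
  rw [h2, inner_zero_left] at h1
  exact inner_self_eq_zero.1 h1.symm

theorem star_creation_mul_eq_ite (i j : Fin N ⊕ Fin N) (p : Prop) [Decidable p]
    (h : fockMatrix m m' i j = if p then 1 else 0) :
    star (waveletCreation m m' i) * waveletCreation m m' j = if p then 1 else 0 := by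
  refine ext_fockVec (isFockMatrix_fockMatrix m m') fun w a => ?_
  refine (star_waveletCreation_waveletCreation m m' i j w a).trans ?_
  rw [h]
  split_ifs
  · rfl
  · exact (congrArg (toFock (isFockMatrix_fockMatrix m m')) (Finsupp.single_zero w)).trans
      (map_zero _)

end Wavelet

/-! ### Biorthogonality, the oscillator algebra and Cuntz–Toeplitz isometries -/

section Oscillator

variable {N : ℕ} {m m' : FilterBank N}

theorem mul_conjTranspose_of_biorthogonal
    (hbi : ∀ᵐ z ∂haarCircle, (loopMatrix m z)ᴴ * loopMatrix m' z = 1) :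
    ∀ᵐ z ∂haarCircle, loopMatrix m z * (loopMatrix m' z)ᴴ = 1 := by
  filter_upwards [hbi] with z hz
  have h := congrArg Matrix.conjTranspose hz
  rw [Matrix.conjTranspose_mul, Matrix.conjTranspose_conjTranspose,
    Matrix.conjTranspose_one] at h
  -- For square matrices a one-sided inverse is two-sided.
  exact mul_eq_one_comm.1 h

variable [NeZero N] (m m')

theorem waveletVec_sum {α : Type*} (s : Finset α) (w : List (Fin N ⊕ Fin N))
    (h : α → L2Circle) :
    waveletVec m m' w (∑ k ∈ s, h k) = ∑ k ∈ s, waveletVec m m' w (h k) :=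
  map_sum ((toFock (isFockMatrix_fockMatrix m m')).comp
    (Finsupp.lsingle w : L2Circle →ₗ[ℂ] (List (Fin N ⊕ Fin N) →₀ L2Circle))) h s

variable {m m'}

theorem star_opT'_mul_opT
    (hbi : ∀ᵐ z ∂haarCircle, (loopMatrix m z)ᴴ * loopMatrix m' z = 1) (i j : Fin N) :
    star (opT' m m' j) * opT m m' i = if i = j then 1 else 0 := by
  refine star_creation_mul_eq_ite m m' _ _ _ ?_
  rw [fockMatrix_apply]
  exact star_waveletOp_mul_of_ae m' m (mul_conjTranspose_of_biorthogonal hbi) j i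

theorem sum_star_opT'_mul
    (hbi : ∀ᵐ z ∂haarCircle, (loopMatrix m z)ᴴ * loopMatrix m' z = 1) (i k : Fin N) :
    ∑ j, star (opT' m m' k) * opT' m m' j * (star (opT m m' j) * opT m m' i)
      = star (opT' m m' k) * opT m m' i := by
  refine ext_fockVec (isFockMatrix_fockMatrix m m') fun w a => ?_
  have h1 : ∀ j, (star (opT' m m' k) * opT' m m' j * (star (opT m m' j) * opT m m' i))
      (waveletVec m m' w a) = waveletVec m m' w ((star (waveletOp m' k) * waveletOp m' j *
        (star (waveletOp m j) * waveletOp m i)) a) := by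
    intro j
    have h2 := star_waveletCreation_waveletCreation m m' (Sum.inl j) (Sum.inl i) w a
    have h3 := star_waveletCreation_waveletCreation m m' (Sum.inr k) (Sum.inr j) w
      (fockMatrix m m' (Sum.inl j) (Sum.inl i) a)
    rw [← h2] at h3
    rw [fockMatrix_apply, fockMatrix_apply] at h3
    exact h3
  have h4 := star_waveletCreation_waveletCreation m m' (Sum.inr k) (Sum.inl i) w a
  rw [fockMatrix_apply] at h4
  have h5 : (∑ j, star (opT' m m' k) * opT' m m' j * (star (opT m m' j) * opT m m' i))
      (waveletVec m m' w a)
      = waveletVec m m' w ((star (waveletOp m' k) * waveletOp m i) a) := by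
    rw [← sum_star_waveletOp_mul m m' hbi i k, sum_apply, sum_apply, waveletVec_sum]
    exact Finset.sum_congr rfl fun j _ => h1 j
  exact h5.trans h4.symm

/-- The difference `x` of the two sides is annihilated by `star T_i`, by biorthogonality, and by
every `star T̃_k`, by the Gram relation. As `star x` is a left combination of these adjoints, `star
x * x = 0`. -/
theorem opT_eq_sum
    (hbi : ∀ᵐ z ∂haarCircle, (loopMatrix m z)ᴴ * loopMatrix m' z = 1) (i : Fin N) :
    opT m m' i = ∑ j, opT' m m' j * (star (opT m m' j) * opT m m' i) := by
  set x := opT m m' i - ∑ j, opT' m m' j * (star (opT m m' j) * opT m m' i) with hx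
  have h1 : star (opT m m' i) * x = 0 := by
    have h2 : ∀ j, star (opT m m' i) * opT' m m' j = if i = j then 1 else 0 := by
      intro j
      have := congrArg star (star_opT'_mul_opT hbi i j)
      rw [star_mul, star_star] at this
      rw [this]
      split_ifs <;> simp
    simp [hx, mul_sub, Finset.mul_sum, ← mul_assoc, h2]
  have h2 : ∀ k, star (opT' m m' k) * x = 0 := by
    intro k
    rw [hx, mul_sub, Finset.mul_sum, ← sum_star_opT'_mul hbi i k]
    simp [mul_assoc]
  have h3 : star x * x = 0 := by
    conv_lhs => rw [hx, star_sub, star_sum]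
    rw [← hx, sub_mul, h1, Finset.sum_mul]
    simp [mul_assoc, h2]
  exact sub_eq_zero.1 (CStarRing.star_mul_self_eq_zero_iff x |>.1 h3)

/-- If the adjoints kill the vacuum sector, `∑ W_i W_i*` kills a nonzero vector and cannot be the
identity. -/
theorem isCuntzToeplitz_of_vacuum {W : Fin N → (WaveletFockSpace m m' →L[ℂ] WaveletFockSpace m m')}
    (hW : ∀ i j, star (W i) * W j = if i = j then 1 else 0)
    (hvac : ∀ i h, star (W i) (waveletVac m m' h) = 0) : IsCuntzToeplitz W := by
  refine ⟨hW, fun hsum => ?_⟩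
  obtain ⟨h, hh⟩ := exists_waveletVac_ne_zero m m'
  refine hh ?_
  have := congrArg (fun T : WaveletFockSpace m m' →L[ℂ] WaveletFockSpace m m' =>
    T (waveletVac m m' h)) hsum
  simpa [sum_apply, hvac] using this.symm

theorem opT_mem_closure_and_exists_isCuntzToeplitz
    (hbi : ∀ᵐ z ∂haarCircle, (loopMatrix m z)ᴴ * loopMatrix m' z = 1) :
    (∀ i, opT m m' i ∈ (algT' m m').topologicalClosure) ∧
      ∃ W : Fin N → (WaveletFockSpace m m' →L[ℂ] WaveletFockSpace m m'),
        (∀ i, W i ∈ (algT' m m').topologicalClosure) ∧ IsCuntzToeplitz W := by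
  obtain ⟨h1, R, hR, hRo⟩ := exists_orthonormalization (algT' m m').topologicalClosure
    (StarSubalgebra.isClosed_topologicalClosure _) (opT m m') (opT' m m')
    (fun i => StarSubalgebra.le_topologicalClosure _ (StarAlgebra.subset_adjoin ℂ _ ⟨i, rfl⟩))
    (fun i j => star_opT'_mul_opT hbi i j) (opT_eq_sum hbi)
  refine ⟨h1, _, hR, isCuntzToeplitz_of_vacuum hRo fun i h => ?_⟩
  rw [star_sum, sum_apply]
  refine Finset.sum_eq_zero fun j _ => ?_
  -- In the adjoint of `T̃_j R_ji` the annihilator `star T̃_j` acts first.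
  rw [star_mul, mul_apply_eq_comp, opT', star_waveletCreation_waveletVac, map_zero]

theorem isOscillatorAlgebra_algT'
    (hbi : ∀ᵐ z ∂haarCircle, (loopMatrix m z)ᴴ * loopMatrix m' z = 1) :
    IsOscillatorAlgebra (particleSpace (isFockMatrix_fockMatrix m m')) (algT' m m')
      (opT m m') (opT' m m') where
  b_mem i := StarAlgebra.subset_adjoin ℂ _ ⟨i, rfl⟩
  a_mem := (opT_mem_closure_and_exists_isCuntzToeplitz hbi).1
  a_raise i := creation_mem_particleSpace _ (waveletCreation_waveletVec m m') _
  b_raise i := creation_mem_particleSpace _ (waveletCreation_waveletVec m m') _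
  a_lower i := star_creation_mem_particleSpace _ (waveletCreation_waveletVec m m')
    (commute_fockMatrix m m') _
  b_lower i := star_creation_mem_particleSpace _ (waveletCreation_waveletVec m m')
    (commute_fockMatrix m m') _
  a_vacuum i := star_creation_particleSpace_zero _ (waveletCreation_waveletVec m m') _
  b_vacuum i := star_creation_particleSpace_zero _ (waveletCreation_waveletVec m m') _
  anticomm i j ψ hψ := by
    have h0 : star (opT' m m' j) ψ = 0 :=
      star_creation_particleSpace_zero _ (waveletCreation_waveletVec m m') _ ψ hψ
    -- Only the first summand needs the vacuum; the second is `δ` on all of the Fock space.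
    rw [h0, map_zero, zero_add, ← mul_apply_eq_comp, star_opT'_mul_opT hbi]
    split_ifs <;> simp

end Oscillator
end WaveletFock

theorem theorem2 (N : ℕ) [NeZero N] (m m' : FilterBank N)
    (hA : ∀ᵐ z ∂haarCircle, IsUnit (loopMatrix m z))
    (hA' : ∀ᵐ z ∂haarCircle, IsUnit (loopMatrix m' z))
    (hbi : ∀ᵐ z ∂haarCircle, (loopMatrix m z)ᴴ * loopMatrix m' z = 1) :
    -- the creation operators are well defined: `T_i (w ⊗ h) = (iw) ⊗ h`
    (∀ i w h, waveletCreation m m' i (waveletVec m m' w h) = waveletVec m m' (i :: w) h) ∧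
    -- `T_i* T_j` restricted to `H`
    (∀ i j (h : L2Circle),
      star (opT m m' i) (opT m m' j (waveletVac m m' h))
          = waveletVac m m' (star (waveletOp m i) (waveletOp m j h)) ∧
        star (waveletOp m i) (waveletOp m j h)
          =ᵐ[haarCircle] fun z => (loopMatrix m z * (loopMatrix m z)ᴴ) j i * h z) ∧
    -- `T̃_i* T̃_j` restricted to `H`
    (∀ i j (h : L2Circle),
      star (opT' m m' i) (opT' m m' j (waveletVac m m' h))
          = waveletVac m m' (star (waveletOp m' i) (waveletOp m' j h)) ∧
        star (waveletOp m' i) (waveletOp m' j h)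
          =ᵐ[haarCircle] fun z => (loopMatrix m' z * (loopMatrix m' z)ᴴ) j i * h z) ∧
    -- the fermionic relation on `H`
    (∀ i j (h : L2Circle),
      opT m m' i (star (opT' m m' j) (waveletVac m m' h))
          + star (opT' m m' j) (opT m m' i (waveletVac m m' h))
        = (if i = j then (1 : ℂ) else 0) • waveletVac m m' h) ∧
    -- the `*`-algebra generated by the `T̃_j` is an oscillator algebra
    IsOscillatorAlgebra (particleSpace (isFockMatrix_fockMatrix m m')) (algT' m m')
      (opT m m') (opT' m m') ∧
    -- whose Fock representation contains Cuntz–Toeplitz isometries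
    (∃ W : Fin N → (WaveletFockSpace m m' →L[ℂ] WaveletFockSpace m m'),
      (∀ i, W i ∈ (algT' m m').topologicalClosure) ∧ IsCuntzToeplitz W) ∧
    ((∀ᵐ z ∂haarCircle, loopMatrix m' z ∈ Matrix.unitaryGroup (Fin N) ℂ) →
      IsCuntzToeplitz (opT' m m')) := by

  refine ⟨waveletCreation_waveletVec m m', fun i j h => ⟨?_, star_waveletOp_waveletOp_ae m m i j h⟩,
    fun i j h => ⟨?_, star_waveletOp_waveletOp_ae m' m' i j h⟩, fun i j h => ?_,
    isOscillatorAlgebra_algT' hbi, (opT_mem_closure_and_exists_isCuntzToeplitz hbi).2,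
    fun hU => isCuntzToeplitz_of_vacuum (fun i j => ?_)
      fun i h => star_waveletCreation_waveletVac m m' _ h⟩
  · refine (star_waveletCreation_waveletCreation m m' (Sum.inl i) (Sum.inl j) [] h).trans ?_
    rw [fockMatrix_apply]
    rfl
  · refine (star_waveletCreation_waveletCreation m m' (Sum.inr i) (Sum.inr j) [] h).trans ?_
    rw [fockMatrix_apply]
    rfl
  · exact (isOscillatorAlgebra_algT' hbi).anticomm i j _
      (fockVec_mem_particleSpace (isFockMatrix_fockMatrix m m') [] h)
  -- Unitarity of `Ã` makes the Gram matrix of the `T̃_i` the identity, so no orthonormalization is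
  -- needed.
  · refine star_creation_mul_eq_ite m m' _ _ _ ?_
    rw [fockMatrix_apply]
    have h1 := star_waveletOp_mul_of_ae m' m'
      (hU.mono fun z hz => Matrix.mem_unitaryGroup_iff.1 hz) i j
    simp only [eq_comm (a := j)] at h1
    exact h1
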